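/- Let $0<\alpha,\beta,\gamma<1$ be fixed and let $P$ be the symmetric matrix with rows and columns indexed by $1,0$ (in this order), $P=\begin{pmatrix}\alpha&\beta\\ \beta&\gamma\end{pmatrix}$, i.e. $P_{1,1}=\alpha$, $P_{1,0}=P_{0,1}=\beta$, $P_{0,0}=\gamma$. The stochastic Kronecker graph $K(n,P)$ is the random simple graph on the vertex set $\mathbb{Z}_2^n$ in which every pair $\{u,v\}$ of distinct vertices is an edge with probability $p_{u,v}=\prod_{i=1}^n P_{u_i,v_i}$, independently of all other pairs. A property holds asymptotically almost surely (a.a.s.) if its probability tends to $1$ as $n\to\infty$. Let $k\ge 3$, let $C_k$ be the cycle of length $k$, and let $X_{C_k}$ be the number of labeled copies of $C_k$ in $K(n,P)$, i.e. the number of injective graph homomorphisms from $C_k$ to $K(n,P)$. **Theorem.** Assume $\alpha=\gamma$. Then the threshold for the appearance of $C_k$ in $K(n,P)$ is $(\alpha+\beta)^k+(\alpha-\beta)^k=1$, that is: * if $(\alpha+\beta)^k+(\alpha-\beta)^k<1$, then a.a.s. $K(n,P)$ contains no copy of $C_k$; * if $(\alpha+\beta)^k+(\alpha-\beta)^k>1$,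 then a.a.s. $K(n,P)$ contains a copy of $C_k$. Additionally, if $(\alpha+\beta)^k+(\alpha-\beta)^k>1$, then a.a.s. $$X_{C_k}=(1+o(1))\left((\alpha+\beta)^k+(\alpha-\beta)^k\right)^n,$$ that is, for every $\varepsilon>0$, a.a.s. $\left|X_{C_k}-\left((\alpha+\beta)^k+(\alpha-\beta)^k\right)^n\right|\le\varepsilon\left((\alpha+\beta)^k+(\alpha-\beta)^k\right)^n$. -/

import Mathlib

open Filter Topology MeasureTheory

/-- The vertex set `ℤ₂ⁿ`: binary strings of length `n`. -/
abbrev BinString (n : ℕ) : Type := Fin n → ZMod 2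

/-- The symmetric matrix `P` with `P 1 1 = α`, `P 1 0 = P 0 1 = β`, `P 0 0 = γ`
(the digit `1` indexes the first row and column). -/
def kroneckerMatrix (α β γ : ℝ) : Matrix (ZMod 2) (ZMod 2) ℝ :=
  Matrix.of fun a b => if a = b then (if a = 1 then α else γ) else β

theorem kroneckerMatrix_symm (α β γ : ℝ) (a b : ZMod 2) :
    kroneckerMatrix α β γ a b = kroneckerMatrix α β γ b a := by
  by_cases h : a = b
  · rw [h]
  · simp [kroneckerMatrix, h, Ne.symm h]

/-- The edge probability `p_{u,v} = ∏ i, P (u i) (v i)`, as a function of the unordered pair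
`{u, v}`. -/
def kroneckerProb (α β γ : ℝ) (n : ℕ) : Sym2 (BinString n) → ℝ :=
  Sym2.lift ⟨fun u v => ∏ i, kroneckerMatrix α β γ (u i) (v i), fun u v =>
    Finset.prod_congr rfl fun i _ => kroneckerMatrix_symm α β γ (u i) (v i)⟩

/-- The Bernoulli law with success probability `p ∈ [0, 1]` on truth values. -/
noncomputable def bernoulliLaw (p : ℝ) : Measure Prop :=
  ENNReal.ofReal p • Measure.dirac True + ENNReal.ofReal (1 - p) • Measure.dirac False

/-- The law of the stochastic Kronecker graph `K(n, P)`: independently for each unordered pair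
`e = {u, v}` of vertices, `e` is selected with probability `p_{u,v}`, and the graph consists of the
selected pairs of distinct vertices (`SimpleGraph.fromEdgeSet` discards the pairs `{u, u}`). -/
noncomputable def stochasticKronecker (α β γ : ℝ) (n : ℕ) :
    Measure (SimpleGraph (BinString n)) :=
  (Measure.pi fun e : Sym2 (BinString n) => bernoulliLaw (kroneckerProb α β γ n e)).map
    fun ω => SimpleGraph.fromEdgeSet {e | ω e}

/-- The property `Q` (of graphs on `ℤ₂ⁿ`, for each `n`) holds asymptotically almost surely in
`K(n, P)`: its probability tends to one as `n → ∞`. -/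
def KroneckerAas (α β γ : ℝ) (Q : ∀ n : ℕ, SimpleGraph (BinString n) → Prop) : Prop :=
  Tendsto (fun n : ℕ => stochasticKronecker α β γ n {G | Q n G}) atTop (𝓝 1)

/-! ### Sums over closed walks in a finite abelian group -/

/-! Since `α = γ`, the matrix entry at `(a, b)` depends only on `b - a`, so the characters of `ℤ₂`
diagonalise the matrix, with eigenvalues `α + β` and `α - β`. The one-digit weight of closed walks
of length `k` is therefore `λ = (α + β) ^ k + (α - β) ^ k`. Digits factor, so the edge probabilities
summed over all closed walks of words give exactly `λ ^ n`. Below the threshold, Markov's inequality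
suffices, because the expected count is at most `λ ^ n`. Above it, two facts are needed. A walk with
a coincidence has one-digit weight less than `λ` (`coincidenceSum_lt`), so the mean is `(1 + o(1)) λ
^ n`. A pair of cycles sharing edges has one-digit weight less than `λ ^ 2`, so the variance is `o(λ
^ (2n))`, and Chebyshev's inequality gives concentration. The variance bound has two sources.
`sum_intersecting_pairs_le` reduces, at a cost depending on `k` only, to pairs that traverse their
common edges at the same times and in the same direction. `overlapSum_lt` treats such pairs, by
characters of `ℤ₂ × ℤ₂` and a weighted AM-GM inequality. -/

/-- A general kernel `h` in the two endpoints makes the induction work: the last step is absorbed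
into `h` by a convolution. Orthogonality is used only for paths of length zero, to expand the
indicator of equal endpoints. -/
theorem sum_paths_eq_sum_characters {A ι : Type*} [AddCommGroup A] [Fintype A] [DecidableEq A]
    [Fintype ι] (χ : ι → A → ℝ) (hmul : ∀ c a b, χ c (a + b) = χ c a * χ c b)
    (horth : ∀ a, ∑ c, χ c a = if a = 0 then (Fintype.card A : ℝ) else 0)
    (m : ℕ) (f : Fin m → A → ℝ) (h : A → A → ℝ) :
    (Fintype.card A : ℝ) *
      ∑ z : Fin (m + 1) → A, (∏ i, f i (z i.succ - z i.castSucc)) * h (z 0) (z (Fin.last m)) =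
      ∑ c, (∏ i, ∑ t, f i t * χ c (-t)) * ∑ a, ∑ b, χ c (b - a) * h a b := by
  induction m generalizing h with
  | zero =>
    have h1 : ∑ z : Fin 1 → A, h (z 0) (z 0) = ∑ a, h a a :=
      Fintype.sum_equiv (Equiv.funUnique (Fin 1) A) _ _ fun _ => rfl
    simp only [Finset.univ_eq_empty, Finset.prod_empty, one_mul, Fin.last_zero]
    rw [h1, Finset.sum_comm, Finset.mul_sum]
    refine Finset.sum_congr rfl fun a _ => ?_
    rw [Finset.sum_comm]
    simp_rw [← Finset.sum_mul, horth, sub_eq_zero]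
    simp
  | succ m ih =>
    have h1 : ∑ z : Fin (m + 1 + 1) → A,
        (∏ i, f i (z i.succ - z i.castSucc)) * h (z 0) (z (Fin.last (m + 1))) =
        ∑ z : Fin (m + 1) → A, (∏ i : Fin m, f i.castSucc (z i.succ - z i.castSucc)) *
          ∑ b, f (Fin.last m) (b - z (Fin.last m)) * h (z 0) b := by
      rw [← (Fin.snocEquiv fun _ : Fin (m + 1 + 1) => A).sum_comp, Fintype.sum_prod_type_right]
      refine Finset.sum_congr rfl fun z _ => ?_
      rw [Finset.mul_sum]
      refine Finset.sum_congr rfl fun b _ => ?_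
      rw [Fin.prod_univ_castSucc]
      have h0 : (0 : Fin (m + 1 + 1)) = Fin.castSucc 0 := rfl
      simp only [Fin.snocEquiv_apply, Fin.succ_castSucc, Fin.snoc_castSucc, Fin.succ_last,
        Fin.snoc_last]
      rw [h0, Fin.snoc_castSucc]
      ring
    rw [h1, ih (fun i => f i.castSucc) fun a c => ∑ b, f (Fin.last m) (b - c) * h a b]
    refine Finset.sum_congr rfl fun c _ => ?_
    rw [Fin.prod_univ_castSucc, mul_assoc]
    congr 1
    rw [Finset.mul_sum]
    refine Finset.sum_congr rfl fun a _ => ?_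
    simp_rw [Finset.mul_sum]
    rw [Finset.sum_comm]
    refine Finset.sum_congr rfl fun b _ => ?_
    -- The increment `t` replaces the penultimate vertex `b - t`, and multiplicativity splits off `χ
    -- c (-t)`.
    rw [Finset.sum_mul, ← (Equiv.subLeft b).sum_comp]
    refine Finset.sum_congr rfl fun t _ => ?_
    have : b - t - a = -t + (b - a) := by abel
    simp only [Equiv.subLeft_apply, sub_sub_cancel]
    rw [this, hmul]
    ring

theorem sum_closed_walks_eq_sum_characters {A ι : Type*} [AddCommGroup A] [Fintype A]
    [DecidableEq A] [Fintype ι] (χ : ι → A → ℝ) (hmul : ∀ c a b, χ c (a + b) = χ c a * χ c b)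
    (horth : ∀ a, ∑ c, χ c a = if a = 0 then (Fintype.card A : ℝ) else 0)
    (k : ℕ) [NeZero k] (f : Fin k → A → ℝ) :
    ∑ z : Fin k → A, ∏ i, f i (z (i + 1) - z i) = ∑ c, ∏ i, ∑ t, f i t * χ c (-t) := by
  obtain ⟨m, rfl⟩ := Nat.exists_eq_succ_of_ne_zero (NeZero.ne k)
  have hA : (Fintype.card A : ℝ) ≠ 0 := by simp
  apply mul_left_cancel₀ hA
  have h1 : ∀ z : Fin (m + 1) → A, ∏ i, f i (z (i + 1) - z i) =
      (∏ i : Fin m, f i.castSucc (z i.succ - z i.castSucc)) *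
        f (Fin.last m) (z 0 - z (Fin.last m)) := by
    intro z
    rw [Fin.prod_univ_castSucc]
    simp [Fin.coeSucc_eq_succ]
  simp_rw [h1]
  rw [sum_paths_eq_sum_characters χ hmul horth m (fun i => f i.castSucc)
    fun a b => f (Fin.last m) (a - b), Finset.mul_sum]
  refine Finset.sum_congr rfl fun c _ => ?_
  rw [Fin.prod_univ_castSucc, mul_left_comm]
  congr 1
  -- The closing step depends only on the difference of the endpoints, so each `b` contributes the
  -- same amount; this produces the factor `Fintype.card A` to be cancelled.
  rw [← nsmul_eq_mul, ← Finset.card_univ, ← Finset.sum_const, Finset.sum_comm]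
  refine Finset.sum_congr rfl fun b _ => ?_
  rw [← Equiv.sum_comp (Equiv.addRight b)]
  refine Finset.sum_congr rfl fun t _ => ?_
  simp [mul_comm]

/-! ### Characters of `ℤ₂` and of `ℤ₂ × ℤ₂` -/

/-- The sign character of `ZMod 2`. -/
def signChar (a : ZMod 2) : ℝ := if a = 0 then 1 else -1

theorem signChar_add (a b : ZMod 2) : signChar (a + b) = signChar a * signChar b := by
  have h : ∀ a : ZMod 2, a = 0 ∨ a = 1 := by decide
  have h2 : (1 : ZMod 2) + 1 = 0 := by decide
  rcases h a with rfl | rfl <;> rcases h b with rfl | rfl <;> simp [signChar, h2]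

theorem sum_zmod_two (f : ZMod 2 → ℝ) : ∑ a, f a = f 0 + f 1 := Fin.sum_univ_two f

/-- The `c`-th power of the sign character. -/
def powSignChar (c a : ZMod 2) : ℝ := if c = 0 then 1 else signChar a

theorem powSignChar_add (c a b : ZMod 2) :
    powSignChar c (a + b) = powSignChar c a * powSignChar c b := by
  unfold powSignChar
  split_ifs
  · simp
  · exact signChar_add a b

theorem sum_powSignChar (a : ZMod 2) : ∑ c, powSignChar c a = if a = 0 then 2 else 0 := by
  rw [sum_zmod_two]
  by_cases h : a = 0 <;> simp [powSignChar, signChar, h]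
  norm_num

/-- The weight of a step `t` in `ℤ₂`: `α` for no change and `β` for a change of digit. -/
def stepWeight (α β : ℝ) (t : ZMod 2) : ℝ := if t = 0 then α else β

/-- Equality of the two diagonal entries is what turns the matrix into a convolution kernel. -/
theorem kroneckerMatrix_eq_stepWeight (α β : ℝ) (a b : ZMod 2) :
    kroneckerMatrix α β α a b = stepWeight α β (b - a) := by
  by_cases h : a = b
  · simp [kroneckerMatrix, stepWeight, h]
  · simp [kroneckerMatrix, stepWeight, h, sub_eq_zero, Ne.symm h]

theorem sum_closed_walks_kroneckerMatrix (α β : ℝ) (k : ℕ) [NeZero k] :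
    ∑ x : Fin k → ZMod 2, ∏ i, kroneckerMatrix α β α (x i) (x (i + 1)) =
      (α + β) ^ k + (α - β) ^ k := by
  simp_rw [kroneckerMatrix_eq_stepWeight]
  rw [sum_closed_walks_eq_sum_characters powSignChar powSignChar_add
    (by simpa using sum_powSignChar) k fun _ => stepWeight α β]
  simp [sum_zmod_two, stepWeight, powSignChar, signChar, sub_eq_add_neg]

/-- The weight of a simultaneous step of two walks in `ℤ₂`: the steps are either counted
separately, or required to agree and counted once. -/
def pairStepWeight (α β : ℝ) (shared : Prop) [Decidable shared] (t : ZMod 2 × ZMod 2) : ℝ :=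
  if shared then if t.1 = t.2 then stepWeight α β t.1 else 0
  else stepWeight α β t.1 * stepWeight α β t.2

/-- The three summands come from the four characters of `ℤ₂ × ℤ₂`, the two mixed ones agreeing. On a
shared step both walks see the same increment, so the two sign characters cancel for `(1, 1)`, which
leaves `α + β` there. -/
theorem sum_closed_walks_pairStepWeight (α β : ℝ) (k : ℕ) [NeZero k] (I : Finset (Fin k)) :
    ∑ z : Fin k → ZMod 2 × ZMod 2, ∏ i, pairStepWeight α β (i ∈ I) (z (i + 1) - z i) =
      (α + β) ^ I.card * ((α + β) ^ 2) ^ Iᶜ.card +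
      2 * ((α - β) ^ I.card * ((α + β) * (α - β)) ^ Iᶜ.card) +
      (α + β) ^ I.card * ((α - β) ^ 2) ^ Iᶜ.card := by
  rw [sum_closed_walks_eq_sum_characters
    (fun (c : ZMod 2 × ZMod 2) a => powSignChar c.1 a.1 * powSignChar c.2 a.2)
    (fun c a b => by simp only [Prod.fst_add, Prod.snd_add, powSignChar_add]; ring)
    (fun a => by
      simp only [Fintype.sum_prod_type, ← Finset.mul_sum, ← Finset.sum_mul, sum_powSignChar]
      by_cases h1 : a.1 = 0 <;> by_cases h2 : a.2 = 0 <;> simp [Prod.ext_iff, h1, h2]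
      norm_num)
    k fun i => pairStepWeight α β (i ∈ I)]
  have key : ∀ (c : ZMod 2 × ZMod 2) (u v : ℝ),
      (∑ t : ZMod 2 × ZMod 2, pairStepWeight α β True t *
        (powSignChar c.1 (-t).1 * powSignChar c.2 (-t).2) = u) →
      (∑ t : ZMod 2 × ZMod 2, pairStepWeight α β False t *
        (powSignChar c.1 (-t).1 * powSignChar c.2 (-t).2) = v) →
      ∏ i : Fin k, ∑ t : ZMod 2 × ZMod 2, pairStepWeight α β (i ∈ I) t *
        (powSignChar c.1 (-t).1 * powSignChar c.2 (-t).2) = u ^ I.card * v ^ Iᶜ.card := by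
    intro c u v hu hv
    rw [← Finset.prod_mul_prod_compl I]
    congr 1
    · rw [← Finset.prod_const]
      refine Finset.prod_congr rfl fun i hi => ?_
      simpa [pairStepWeight, hi] using hu
    · rw [← Finset.prod_const]
      refine Finset.prod_congr rfl fun i hi => ?_
      simpa [pairStepWeight, Finset.mem_compl.1 hi] using hv
  rw [Fintype.sum_prod_type, sum_zmod_two, sum_zmod_two, sum_zmod_two,
    key (0, 0) (α + β) ((α + β) ^ 2), key (0, 1) (α - β) ((α + β) * (α - β)),
    key (1, 0) (α - β) ((α + β) * (α - β)), key (1, 1) (α + β) ((α - β) ^ 2)]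
  · ring
  all_goals
    simp [Fintype.sum_prod_type, sum_zmod_two, pairStepWeight, stepWeight, powSignChar, signChar]
    try ring

theorem stepWeight_nonneg {α β : ℝ} (hα : 0 ≤ α) (hβ : 0 ≤ β) (t : ZMod 2) :
    0 ≤ stepWeight α β t := by
  unfold stepWeight
  split_ifs <;> assumption

theorem kroneckerMatrix_pos {α β : ℝ} (hα : 0 < α) (hβ : 0 < β) (a b : ZMod 2) :
    0 < kroneckerMatrix α β α a b := by
  rw [kroneckerMatrix_eq_stepWeight, stepWeight]
  split_ifs <;> assumption

theorem kroneckerMatrix_le_one {α β : ℝ} (hα : α ≤ 1) (hβ : β ≤ 1) (a b : ZMod 2) :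
    kroneckerMatrix α β α a b ≤ 1 := by
  rw [kroneckerMatrix_eq_stepWeight, stepWeight]
  split_ifs <;> assumption

theorem pairStepWeight_nonneg {α β : ℝ} (hα : 0 ≤ α) (hβ : 0 ≤ β) (s : Prop) [Decidable s]
    (t : ZMod 2 × ZMod 2) : 0 ≤ pairStepWeight α β s t := by
  have := stepWeight_nonneg hα hβ
  unfold pairStepWeight
  split_ifs
  · exact this _
  · exact le_rfl
  · exact mul_nonneg (this _) (this _)

/-! ### One-digit weight of overlapping pairs -/

/-- Pairs of closed walks that agree at a given time make up half of the translation-invariant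
pair weight. -/
theorem two_mul_sum_pinned {k : ℕ} (i₀ : Fin k)
    (W : (Fin k → ZMod 2) → (Fin k → ZMod 2) → ℝ)
    (hW : ∀ x y, W x (fun i => y i + 1) = W x y) :
    2 * ∑ x, ∑ y, (if x i₀ = y i₀ then W x y else 0) = ∑ x, ∑ y, W x y := by
  rw [Finset.mul_sum]
  refine Finset.sum_congr rfl fun x _ => ?_
  -- Flipping every digit of `y` preserves the weight and exchanges agreement with disagreement at
  -- `i₀`.
  have h1 : ∑ y, (if x i₀ = y i₀ then W x y else 0) =
      ∑ y, (if x i₀ = y i₀ then 0 else W x y) := by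
    rw [← Equiv.sum_comp (Equiv.addRight (fun _ : Fin k => (1 : ZMod 2)))]
    refine Finset.sum_congr rfl fun y _ => ?_
    have h2 : ∀ a b : ZMod 2, a = b + 1 ↔ ¬ a = b := by decide
    have h3 : W x (y + fun _ => 1) = W x y := hW x y
    simp only [Equiv.coe_addRight, Pi.add_apply, h2, h3, ite_not]
  rw [two_mul]
  conv_lhs => rw [h1]
  conv_lhs => enter [2]; rw [← h1]
  rw [← Finset.sum_add_distrib]
  refine Finset.sum_congr rfl fun y _ => ?_
  split_ifs <;> simp

/-- The one-digit weight of pairs of closed walks of length `k` that share the steps in `I`. -/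
noncomputable def overlapSum (α β : ℝ) (k : ℕ) [NeZero k] (I : Finset (Fin k)) : ℝ :=
  ∑ x : Fin k → ZMod 2, ∑ y : Fin k → ZMod 2,
    if ∀ i ∈ I, x i = y i ∧ x (i + 1) = y (i + 1) then
      (∏ i, kroneckerMatrix α β α (x i) (x (i + 1))) *
        ∏ i ∈ Iᶜ, kroneckerMatrix α β α (y i) (y (i + 1))
    else 0

theorem overlapSum_nonneg {α β : ℝ} (hα : 0 < α) (hβ : 0 < β) (k : ℕ) [NeZero k]
    (I : Finset (Fin k)) : 0 ≤ overlapSum α β k I := by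
  refine Finset.sum_nonneg fun x _ => Finset.sum_nonneg fun y _ => ?_
  have := fun a b => (kroneckerMatrix_pos hα hβ a b).le
  split_ifs
  · exact mul_nonneg (Finset.prod_nonneg fun _ _ => this _ _)
      (Finset.prod_nonneg fun _ _ => this _ _)
  · exact le_rfl

/-- Agreement on the steps in `I` is relaxed to equal increments there together with agreement at
one time `i₀`. Dropping the latter exactly doubles the sum and leaves a translation-invariant one.
The factor 2 is essential, since one-digit weights are later raised to the power `n`. -/
theorem two_mul_overlapSum_le {α β : ℝ} (hα : 0 < α) (hβ : 0 < β) (k : ℕ) [NeZero k]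
    {I : Finset (Fin k)} (hI : I.Nonempty) :
    2 * overlapSum α β k I ≤
      (α + β) ^ I.card * ((α + β) ^ 2) ^ Iᶜ.card +
      2 * ((α - β) ^ I.card * ((α + β) * (α - β)) ^ Iᶜ.card) +
      (α + β) ^ I.card * ((α - β) ^ 2) ^ Iᶜ.card := by
  obtain ⟨i₀, hi₀⟩ := hI
  rw [← sum_closed_walks_pairStepWeight,
    ← Equiv.sum_comp (Equiv.arrowProdEquivProdArrow (Fin k) (fun _ => ZMod 2) (fun _ => ZMod 2)).symm,
    Fintype.sum_prod_type]
  rw [← two_mul_sum_pinned i₀]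
  · refine mul_le_mul_of_nonneg_left ?_ zero_le_two
    refine Finset.sum_le_sum fun x _ => Finset.sum_le_sum fun y _ => ?_
    have hnn : 0 ≤ ∏ i, pairStepWeight α β (i ∈ I)
        ((Equiv.arrowProdEquivProdArrow (Fin k) (fun _ => ZMod 2) (fun _ => ZMod 2)).symm
          (x, y) (i + 1) -
        (Equiv.arrowProdEquivProdArrow (Fin k) (fun _ => ZMod 2) (fun _ => ZMod 2)).symm
          (x, y) i) :=
      Finset.prod_nonneg fun _ _ => pairStepWeight_nonneg hα.le hβ.le _ _
    by_cases h : ∀ i ∈ I, x i = y i ∧ x (i + 1) = y (i + 1)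
    · rw [if_pos h, if_pos (h i₀ hi₀).1, ← Finset.prod_mul_prod_compl I, ← Finset.prod_mul_prod_compl I,
        mul_assoc, ← Finset.prod_mul_distrib]
      refine le_of_eq (congrArg₂ _ ?_ ?_)
      · refine Finset.prod_congr rfl fun i hi => ?_
        obtain ⟨h1, h2⟩ := h i hi
        simp [pairStepWeight, hi, kroneckerMatrix_eq_stepWeight, h1, h2]
      · refine Finset.prod_congr rfl fun i hi => ?_
        simp [pairStepWeight, Finset.mem_compl.1 hi, kroneckerMatrix_eq_stepWeight]
    · rw [if_neg h]
      split_ifs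
      · exact hnn
      · exact le_rfl
  · intro x y
    refine Finset.prod_congr rfl fun i _ => ?_
    congr 1
    simp

/-! ### The inequality behind the variance bound -/

theorem weighted_am_gm_pow {a b : ℝ} (ha : 0 ≤ a) (hb : 0 ≤ b) {s t k : ℕ} (hk : k ≠ 0)
    (hst : s + t = k) : (k : ℝ) * (a ^ s * b ^ t) ≤ s * a ^ k + t * b ^ k := by
  have hk' : (0 : ℝ) < k := by exact_mod_cast Nat.pos_of_ne_zero hk
  have hroot : ∀ {c : ℝ} (_ : 0 ≤ c) (r : ℕ), (c ^ k) ^ ((r : ℝ) / k) = c ^ r := by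
    intro c hc r
    rw [← Real.rpow_natCast_mul hc, mul_div_cancel₀ _ hk'.ne', Real.rpow_natCast]
  have h := Real.geom_mean_le_arith_mean2_weighted (w₁ := (s : ℝ) / k) (w₂ := (t : ℝ) / k)
    (by positivity) (by positivity) (pow_nonneg ha k) (pow_nonneg hb k)
    (by rw [← add_div, div_eq_one_iff_eq hk'.ne']; exact_mod_cast hst)
  rw [hroot ha, hroot hb] at h
  calc (k : ℝ) * (a ^ s * b ^ t) ≤ k * (s / k * a ^ k + t / k * b ^ k) :=
        mul_le_mul_of_nonneg_left h hk'.le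
    _ = s * a ^ k + t * b ^ k := by field_simp

/-- Put `A = S ^ k` and `B = D ^ k`. The first two terms equal `(A + 2B) S ^ t`. AM-GM bounds `k S ^
t` by `s + tA` and `k S ^ s D ^ (2t)` by `sA + tB²`. Hence `k` times the left side is at most `2s(A
+ B) + t(A + B)²`, which is less than `2(s + t)(A + B)²` because `A + B > 1`. -/
theorem overlap_bound_lt {S D : ℝ} (hS : 0 ≤ S) (hD : -1 < D) {k s t : ℕ}
    (hk : k ≠ 0) (hst : s + t = k) (hlam : 1 < S ^ k + D ^ k) :
    S ^ s * (S ^ 2) ^ t + 2 * (D ^ s * (S * D) ^ t) + S ^ s * (D ^ 2) ^ t <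
      2 * (S ^ k + D ^ k) ^ 2 := by
  have hk' : (0 : ℝ) < k := by exact_mod_cast Nat.pos_of_ne_zero hk
  have hDk : -1 < D ^ k := by
    rcases le_or_gt 0 D with h | h
    · exact lt_of_lt_of_le (by norm_num) (pow_nonneg h k)
    · have : |D ^ k| < 1 := by
        rw [abs_pow]
        exact pow_lt_one₀ (abs_nonneg _) (by rw [abs_of_neg h]; linarith) hk
      exact (abs_lt.1 this).1
  have h1 := weighted_am_gm_pow zero_le_one hS hk hst
  have h2 := weighted_am_gm_pow hS (sq_nonneg D) hk hst
  rw [one_pow, one_pow, one_mul] at h1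
  have hstR : (s : ℝ) + t = k := by exact_mod_cast hst
  have e1 : S ^ s * (S ^ 2) ^ t + 2 * (D ^ s * (S * D) ^ t) = (S ^ k + 2 * D ^ k) * S ^ t := by
    rw [← hst]; ring
  have e2 : (D ^ 2) ^ k = (D ^ k) ^ 2 := by rw [← pow_mul, ← pow_mul, mul_comm]
  rw [e1]
  rw [e2] at h2
  -- Here `A + 2B > 0` follows from `A + B > 1` and `B > -1`.
  have h3 := mul_le_mul_of_nonneg_left h1 (show 0 ≤ S ^ k + 2 * D ^ k by linarith)
  refine lt_of_mul_lt_mul_left ?_ hk'.le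
  set A := S ^ k
  set B := D ^ k
  have hs : (0 : ℝ) ≤ s := Nat.cast_nonneg s
  have ht : (0 : ℝ) ≤ t := Nat.cast_nonneg t
  have h4 : 0 ≤ (s : ℝ) * ((A + B) * (A + B - 1)) :=
    mul_nonneg hs (mul_nonneg (by linarith) (by linarith))
  have h5 : 0 ≤ (t : ℝ) * ((A + B) ^ 2) := mul_nonneg ht (sq_nonneg _)
  -- This is the gap between the two sides; it is strict because `s` and `t` are not both zero.
  have h6 : 0 < (s : ℝ) * ((A + B) * (A + B - 1)) * 2 + (t : ℝ) * ((A + B) ^ 2) := by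
    rcases Nat.eq_zero_or_pos t with h | h
    · have : (0 : ℝ) < s := by rw [← hstR, h] at hk'; simpa using hk'
      have := mul_pos this (mul_pos (show 0 < A + B by linarith) (show 0 < A + B - 1 by linarith))
      linarith
    · have : (0 : ℝ) < t := by exact_mod_cast h
      have := mul_pos this (pow_pos (show 0 < A + B by linarith) 2)
      linarith
  rw [← hstR] at h2 h3 ⊢
  nlinarith

theorem overlapSum_lt {α β : ℝ} (hα : 0 < α) (hβ : 0 < β) (hβ1 : β < 1) {k : ℕ} [NeZero k]
    {I : Finset (Fin k)} (hI : I.Nonempty) (hlam : 1 < (α + β) ^ k + (α - β) ^ k) :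
    overlapSum α β k I < ((α + β) ^ k + (α - β) ^ k) ^ 2 := by
  have h1 := two_mul_overlapSum_le hα hβ k hI
  have h2 := overlap_bound_lt (S := α + β) (D := α - β) (by positivity) (by linarith)
    (NeZero.ne k) ((Finset.card_add_card_compl I).trans (Fintype.card_fin k)) hlam
  linarith

/-! ### Passing to binary strings of length `n` -/

theorem sum_prod_digits {k : ℕ} (n : ℕ) (g : (Fin k → ZMod 2) → ℝ) :
    ∑ φ : Fin k → BinString n, ∏ j, g (fun i => φ i j) = (∑ x, g x) ^ n := by
  rw [Fintype.sum_pow]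
  exact Fintype.sum_equiv (Equiv.piComm _) _ _ fun _ => rfl

theorem sum_sum_prod_digits {k : ℕ} (n : ℕ) (g : (Fin k → ZMod 2) → (Fin k → ZMod 2) → ℝ) :
    ∑ φ : Fin k → BinString n, ∑ ψ : Fin k → BinString n,
      ∏ j, g (fun i => φ i j) (fun i => ψ i j) = (∑ x, ∑ y, g x y) ^ n := by
  rw [← Fintype.sum_prod_type', ← Fintype.sum_prod_type', Fintype.sum_pow]
  exact Fintype.sum_equiv
    (((Equiv.piComm _).prodCongr (Equiv.piComm _)).trans
      (Equiv.arrowProdEquivProdArrow (Fin n) _ _).symm) _ _ fun _ => rfl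

theorem kroneckerProb_mk (α β γ : ℝ) (n : ℕ) (u v : BinString n) :
    kroneckerProb α β γ n s(u, v) = ∏ i, kroneckerMatrix α β γ (u i) (v i) := rfl

theorem sum_kroneckerProb (α β : ℝ) (k n : ℕ) [NeZero k] :
    ∑ φ : Fin k → BinString n, ∏ i, kroneckerProb α β α n s(φ i, φ (i + 1)) =
      ((α + β) ^ k + (α - β) ^ k) ^ n := by
  rw [← sum_closed_walks_kroneckerMatrix, ← sum_prod_digits]
  refine Finset.sum_congr rfl fun φ _ => ?_
  simp_rw [kroneckerProb_mk]
  exact Finset.prod_comm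

/-- Words agree exactly when all their digits agree, so the indicator factors over digits along with
the probabilities. -/
theorem sum_kroneckerProb_overlap (α β : ℝ) (k n : ℕ) [NeZero k] (I : Finset (Fin k)) :
    ∑ φ : Fin k → BinString n, ∑ ψ : Fin k → BinString n,
      (if ∀ i ∈ I, φ i = ψ i ∧ φ (i + 1) = ψ (i + 1) then
        (∏ i, kroneckerProb α β α n s(φ i, φ (i + 1))) *
          ∏ i ∈ Iᶜ, kroneckerProb α β α n s(ψ i, ψ (i + 1)) else 0) =
      overlapSum α β k I ^ n := by
  rw [overlapSum, ← sum_sum_prod_digits]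
  refine Finset.sum_congr rfl fun φ _ => Finset.sum_congr rfl fun ψ _ => ?_
  rw [Finset.prod_ite_zero, Finset.prod_mul_distrib]
  by_cases h : ∀ i ∈ I, φ i = ψ i ∧ φ (i + 1) = ψ (i + 1)
  · rw [if_pos h, if_pos fun j _ i hi => ⟨congrFun (h i hi).1 j, congrFun (h i hi).2 j⟩]
    simp_rw [kroneckerProb_mk]
    exact congrArg₂ _ Finset.prod_comm Finset.prod_comm
  · rw [if_neg h, if_neg fun h' => h fun i hi =>
      ⟨funext fun j => (h' j (Finset.mem_univ j) i hi).1,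
        funext fun j => (h' j (Finset.mem_univ j) i hi).2⟩]

/-- The one-digit weight of the closed walks of length `k` with equal digits at times `i`, `j`. -/
noncomputable def coincidenceSum (α β : ℝ) (k : ℕ) [NeZero k] (i j : Fin k) : ℝ :=
  ∑ x : Fin k → ZMod 2,
    if x i = x j then ∏ l, kroneckerMatrix α β α (x l) (x (l + 1)) else 0

theorem coincidenceSum_nonneg {α β : ℝ} (hα : 0 < α) (hβ : 0 < β) (k : ℕ) [NeZero k]
    (i j : Fin k) : 0 ≤ coincidenceSum α β k i j := by
  refine Finset.sum_nonneg fun x _ => ?_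
  split_ifs
  · exact Finset.prod_nonneg fun _ _ => (kroneckerMatrix_pos hα hβ _ _).le
  · exact le_rfl

/-- The restriction drops the walk `Pi.single i 1`, whose weight is positive. -/
theorem coincidenceSum_lt {α β : ℝ} (hα : 0 < α) (hβ : 0 < β) {k : ℕ} [NeZero k]
    {i j : Fin k} (hij : i ≠ j) :
    coincidenceSum α β k i j < (α + β) ^ k + (α - β) ^ k := by
  have hpos : ∀ x : Fin k → ZMod 2, 0 < ∏ l, kroneckerMatrix α β α (x l) (x (l + 1)) :=
    fun x => Finset.prod_pos fun _ _ => kroneckerMatrix_pos hα hβ _ _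
  rw [← sum_closed_walks_kroneckerMatrix]
  refine Finset.sum_lt_sum (fun x _ => ?_) ⟨Pi.single i 1, Finset.mem_univ _, ?_⟩
  · split_ifs
    · exact le_rfl
    · exact (hpos x).le
  · rw [if_neg (by simp [hij.symm])]
    exact hpos _

theorem sum_kroneckerProb_coincidence (α β : ℝ) (k n : ℕ) [NeZero k] (i j : Fin k) :
    ∑ φ : Fin k → BinString n,
      (if φ i = φ j then ∏ l, kroneckerProb α β α n s(φ l, φ (l + 1)) else 0) =
      coincidenceSum α β k i j ^ n := by
  rw [coincidenceSum, ← sum_prod_digits]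
  refine Finset.sum_congr rfl fun φ _ => ?_
  rw [Finset.prod_ite_zero]
  by_cases h : φ i = φ j
  · rw [if_pos h, if_pos fun m _ => congrFun h m]
    simp_rw [kroneckerProb_mk]
    exact Finset.prod_comm
  · rw [if_neg h, if_neg fun h' => h (funext fun m => h' m (Finset.mem_univ m))]

/-! ### Pairs of closed walks sharing an edge -/

/-- Cauchy–Schwarz over the label classes: pairs with different labels are traded for pairs with the
same label. -/
theorem sq_sum_le_card_mul_sum_same_label {ι κ : Type*} [Fintype κ] [DecidableEq κ]
    (s : Finset ι) (c : ι → κ) (a : ι → ℝ) :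
    (∑ x ∈ s, a x) ^ 2 ≤
      Fintype.card κ * ∑ x ∈ s, ∑ y ∈ s, if c x = c y then a x * a y else 0 := by
  have h1 : ∑ x ∈ s, a x = ∑ l, ∑ x ∈ s, if c x = l then a x else 0 := by
    rw [Finset.sum_comm]
    simp
  have h2 : ∑ x ∈ s, ∑ y ∈ s, (if c x = c y then a x * a y else 0) =
      ∑ l, (∑ x ∈ s, if c x = l then a x else 0) ^ 2 := by
    simp_rw [sq, Finset.sum_mul_sum]
    symm
    rw [Finset.sum_comm]
    refine Finset.sum_congr rfl fun x _ => ?_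
    rw [Finset.sum_comm]
    refine Finset.sum_congr rfl fun y _ => ?_
    rw [Finset.sum_eq_single (c x)]
    · simp [eq_comm]
    · intro l _ hl
      simp [hl.symm]
    · simp
  rw [h1, h2]
  exact sq_sum_le_card_mul_sum_sq

section CycleEdges

variable {V : Type*} {k : ℕ} [NeZero k]

/-- The `i`-th edge of the closed walk `φ`. -/
def cycleEdge (φ : Fin k → V) (i : Fin k) : Sym2 V := s(φ i, φ (i + 1))

theorem Fin.add_one_add_one_ne (hk : 3 ≤ k) (i : Fin k) : i + 1 + 1 ≠ i := by
  obtain ⟨m, rfl⟩ := Nat.exists_eq_add_of_le' hk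
  intro h
  rw [add_assoc, add_eq_left] at h
  have := congrArg Fin.val h
  rw [Fin.val_add] at this
  simp [Nat.mod_eq_of_lt] at this

theorem Fin.add_one_ne_self (hk : 2 ≤ k) (i : Fin k) : i + 1 ≠ i := by
  obtain ⟨m, rfl⟩ := Nat.exists_eq_add_of_le' hk
  simp

theorem cycleEdge_injective (hk : 3 ≤ k) {φ : Fin k → V} (hφ : Function.Injective φ) :
    Function.Injective (cycleEdge φ) := by
  intro i j h
  rcases Sym2.eq_iff.1 h with ⟨h1, _⟩ | ⟨h1, h2⟩
  · exact hφ h1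
  · have h1 := hφ h1
    have h2 := hφ h2
    rw [h1] at h2
    exact absurd h2 (Fin.add_one_add_one_ne hk j)

variable [DecidableEq V]

/-- The edge set of the closed walk `φ`. -/
def cycleEdges (φ : Fin k → V) : Finset (Sym2 V) := Finset.univ.image (cycleEdge φ)

theorem prod_cycleEdges (hk : 3 ≤ k) {φ : Fin k → V} (hφ : Function.Injective φ)
    (p : Sym2 V → ℝ) : ∏ e ∈ cycleEdges φ, p e = ∏ i, p (cycleEdge φ i) :=
  Finset.prod_image fun _ _ _ _ h => cycleEdge_injective hk hφ h

/-- The weight of a pair of closed walks that agree on the steps in `I`, with the shared steps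
counted once. -/
def agreeWeight (p : Sym2 V → ℝ) (I : Finset (Fin k)) (φ ψ : Fin k → V) : ℝ :=
  if ∀ i ∈ I, φ i = ψ i ∧ φ (i + 1) = ψ (i + 1) then
    (∏ i, p (cycleEdge φ i)) * ∏ i ∈ Iᶜ, p (cycleEdge ψ i) else 0

theorem agreeWeight_nonneg {p : Sym2 V → ℝ} (hp : ∀ e, 0 ≤ p e) (I : Finset (Fin k))
    (φ ψ : Fin k → V) : 0 ≤ agreeWeight p I φ ψ := by
  unfold agreeWeight
  split_ifs
  · exact mul_nonneg (Finset.prod_nonneg fun _ _ => hp _) (Finset.prod_nonneg fun _ _ => hp _)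
  · exact le_rfl

theorem prod_cycleEdges_sdiff (hk : 3 ≤ k) {φ : Fin k → V} (hφ : Function.Injective φ)
    (p : Sym2 V → ℝ) (H : Finset (Sym2 V)) :
    ∏ e ∈ cycleEdges φ \ H, p e =
      ∏ i ∈ (Finset.univ.filter fun i => cycleEdge φ i ∈ H)ᶜ, p (cycleEdge φ i) := by
  rw [← Finset.prod_image (g := cycleEdge φ) fun _ _ _ _ h => cycleEdge_injective hk hφ h]
  refine Finset.prod_congr ?_ fun _ _ => rfl
  ext e
  simp only [cycleEdges, Finset.mem_sdiff, Finset.mem_image, Finset.mem_univ, true_and,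
    Finset.mem_compl, Finset.mem_filter]
  constructor
  · rintro ⟨⟨i, rfl⟩, h⟩
    exact ⟨i, h, rfl⟩
  · rintro ⟨i, h, rfl⟩
    exact ⟨⟨i, rfl⟩, h⟩

theorem image_filter_cycleEdge {φ : Fin k → V} {H : Finset (Sym2 V)} (hH : H ⊆ cycleEdges φ) :
    (Finset.univ.filter fun i => cycleEdge φ i ∈ H).image (cycleEdge φ) = H := by
  ext e
  simp only [Finset.mem_image, Finset.mem_filter, Finset.mem_univ, true_and]
  constructor
  · rintro ⟨i, h, rfl⟩
    exact h
  · intro h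
    obtain ⟨i, -, rfl⟩ := Finset.mem_image.1 (hH h)
    exact ⟨i, h, rfl⟩

theorem prod_union_eq {s t : Finset (Sym2 V)} (p : Sym2 V → ℝ) :
    ∏ e ∈ s ∪ t, p e =
      (∏ e ∈ s ∩ t, p e) * ((∏ e ∈ s \ (s ∩ t), p e) * ∏ e ∈ t \ (s ∩ t), p e) := by
  rw [← Finset.sdiff_union_self_eq_union, Finset.prod_union Finset.sdiff_disjoint,
    ← Finset.prod_sdiff (Finset.inter_subset_right (s₁ := s) (s₂ := t)),
    Finset.sdiff_inter_self_left]
  ring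

variable [Fintype V]

/-- The injective closed walks of length `k` that traverse every pair in `H`. -/
def cyclesThrough (k : ℕ) [NeZero k] (H : Finset (Sym2 V)) : Finset (Fin k → V) :=
  Finset.univ.filter fun φ => Function.Injective φ ∧ H ⊆ cycleEdges φ

/-- Fix a reference walk `θ` through `H`. The label of `φ` records which steps lie in `H` and the
positions along `θ` of their endpoints. Every endpoint of an edge of `H` lies on `θ`, so equal
positions mean equal vertices. The number of labels depends on `k` only, not on the vertex set. -/
theorem exists_label (k : ℕ) [NeZero k] (H : Finset (Sym2 V)) :
    ∃ c : (Fin k → V) → Fin k → Option (Fin k × Fin k),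
      ∀ φ ∈ cyclesThrough k H, ∀ ψ ∈ cyclesThrough k H, c φ = c ψ → ∀ i,
        (cycleEdge φ i ∈ H ↔ cycleEdge ψ i ∈ H) ∧
        (cycleEdge φ i ∈ H → φ i = ψ i ∧ φ (i + 1) = ψ (i + 1)) := by
  rcases (cyclesThrough k H : Finset (Fin k → V)).eq_empty_or_nonempty with h0 | ⟨θ, hθ⟩
  · simp [h0]
  · have hθ := (Finset.mem_filter.1 hθ).2.2
    have hinv : ∀ φ : Fin k → V, ∀ i, cycleEdge φ i ∈ H →
        θ (Function.invFun θ (φ i)) = φ i ∧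
          θ (Function.invFun θ (φ (i + 1))) = φ (i + 1) := by
      intro φ i hi
      obtain ⟨j, -, hj⟩ := Finset.mem_image.1 (hθ hi)
      rcases Sym2.eq_iff.1 hj with ⟨h1, h2⟩ | ⟨h1, h2⟩
      · exact ⟨Function.invFun_eq ⟨_, h1⟩, Function.invFun_eq ⟨_, h2⟩⟩
      · exact ⟨Function.invFun_eq ⟨_, h2⟩, Function.invFun_eq ⟨_, h1⟩⟩
    refine ⟨fun φ i => if cycleEdge φ i ∈ H then
      some (Function.invFun θ (φ i), Function.invFun θ (φ (i + 1))) else none, ?_⟩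
    intro φ _ ψ _ hc i
    have hc := congrFun hc i
    dsimp only at hc
    by_cases h1 : cycleEdge φ i ∈ H <;> by_cases h2 : cycleEdge ψ i ∈ H
    · rw [if_pos h1, if_pos h2, Option.some_inj, Prod.mk.injEq] at hc
      refine ⟨iff_of_true h1 h2, fun _ => ⟨?_, ?_⟩⟩
      · rw [← (hinv φ i h1).1, ← (hinv ψ i h2).1, hc.1]
      · rw [← (hinv φ i h1).2, ← (hinv ψ i h2).2, hc.2]
    · simp [h1, h2] at hc
    · simp [h1, h2] at hc
    · exact ⟨iff_of_false h1 h2, fun h => absurd h h1⟩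

/-- The set `I` of times at which `φ` traverses `H` gives equality, as `ψ` has the same set. The
bound is stated as a sum over all `I` because `φ` and `I` determine `H`, so a later sum over `H`
collapses. -/
theorem shared_term_le (hk : 3 ≤ k) {p : Sym2 V → ℝ} (hp : ∀ e, 0 ≤ p e)
    {H : Finset (Sym2 V)} (hH : H.Nonempty) {φ ψ : Fin k → V}
    (hφ : φ ∈ cyclesThrough k H) (hψ : ψ ∈ cyclesThrough k H)
    (h : ∀ i, (cycleEdge φ i ∈ H ↔ cycleEdge ψ i ∈ H) ∧
        (cycleEdge φ i ∈ H → φ i = ψ i ∧ φ (i + 1) = ψ (i + 1))) :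
    (∏ e ∈ H, p e) * ((∏ e ∈ cycleEdges φ \ H, p e) * ∏ e ∈ cycleEdges ψ \ H, p e) ≤
      ∑ I : Finset (Fin k), if I.Nonempty ∧ I.image (cycleEdge φ) = H then
        agreeWeight p I φ ψ else 0 := by
  obtain ⟨hφi, hφH⟩ := (Finset.mem_filter.1 hφ).2
  obtain ⟨hψi, hψH⟩ := (Finset.mem_filter.1 hψ).2
  set I : Finset (Fin k) := Finset.univ.filter fun i => cycleEdge φ i ∈ H with hI
  have himg : I.image (cycleEdge φ) = H := image_filter_cycleEdge hφH
  have hne : I.Nonempty := by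
    rw [← Finset.image_nonempty (f := cycleEdge φ), himg]
    exact hH
  have hI' : I = Finset.univ.filter fun i => cycleEdge ψ i ∈ H :=
    Finset.filter_congr fun i _ => (h i).1
  refine le_trans (le_of_eq ?_) (Finset.single_le_sum (fun J _ => ?_) (Finset.mem_univ I))
  · rw [if_pos ⟨hne, himg⟩, agreeWeight,
      if_pos (show ∀ i ∈ I, φ i = ψ i ∧ φ (i + 1) = ψ (i + 1) from
        fun i hi => (h i).2 (Finset.mem_filter.1 hi).2), ← mul_assoc,
      mul_comm (∏ e ∈ H, p e), prod_cycleEdges_sdiff hk hψi, ← hI',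
      Finset.prod_sdiff hφH, prod_cycleEdges hk hφi]
  · split_ifs
    · exact agreeWeight_nonneg hp _ _ _
    · exact le_rfl

/-- The injective closed walks of length `k`. -/
def injWalks (V : Type*) [Fintype V] [DecidableEq V] (k : ℕ) [NeZero k] : Finset (Fin k → V) :=
  Finset.univ.filter fun φ => Function.Injective φ

theorem sum_intersecting_pairs_le (hk : 3 ≤ k) {p : Sym2 V → ℝ} (hp : ∀ e, 0 ≤ p e) :
    ∑ φ ∈ injWalks V k, ∑ ψ ∈ injWalks V k,
      (if (cycleEdges φ ∩ cycleEdges ψ).Nonempty then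
        ∏ e ∈ cycleEdges φ ∪ cycleEdges ψ, p e else 0) ≤
      Fintype.card (Fin k → Option (Fin k × Fin k)) *
        ∑ I : Finset (Fin k), if I.Nonempty then ∑ φ, ∑ ψ, agreeWeight p I φ ψ else 0 := by
  have hpn : ∀ s : Finset (Sym2 V), 0 ≤ ∏ e ∈ s, p e := fun s => Finset.prod_nonneg fun _ _ => hp _
  -- The single choice `H = cycleEdges φ ∩ cycleEdges ψ` accounts for the pair. Admitting every
  -- nonempty common subset only increases the sum, and makes the part belonging to each `H` a
  -- perfect square.
  have step1 : ∑ φ ∈ injWalks V k, ∑ ψ ∈ injWalks V k,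
      (if (cycleEdges φ ∩ cycleEdges ψ).Nonempty then
        ∏ e ∈ cycleEdges φ ∪ cycleEdges ψ, p e else 0) ≤
      ∑ H ∈ (Finset.univ.filter Finset.Nonempty : Finset (Finset (Sym2 V))),
        (∏ e ∈ H, p e) * (∑ φ ∈ cyclesThrough k H, ∏ e ∈ cycleEdges φ \ H, p e) ^ 2 := by
    calc _ ≤ ∑ φ ∈ injWalks V k, ∑ ψ ∈ injWalks V k,
          ∑ H ∈ (Finset.univ.filter Finset.Nonempty : Finset (Finset (Sym2 V))),
            if H ⊆ cycleEdges φ ∧ H ⊆ cycleEdges ψ then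
              (∏ e ∈ H, p e) * ((∏ e ∈ cycleEdges φ \ H, p e) * ∏ e ∈ cycleEdges ψ \ H, p e)
            else 0 := by
          refine Finset.sum_le_sum fun φ _ => Finset.sum_le_sum fun ψ _ => ?_
          have hnn : ∀ H ∈ (Finset.univ.filter Finset.Nonempty : Finset (Finset (Sym2 V))),
              0 ≤ if H ⊆ cycleEdges φ ∧ H ⊆ cycleEdges ψ then
                (∏ e ∈ H, p e) * ((∏ e ∈ cycleEdges φ \ H, p e) * ∏ e ∈ cycleEdges ψ \ H, p e)
              else 0 := by
            intro H _
            split_ifs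
            · exact mul_nonneg (hpn _) (mul_nonneg (hpn _) (hpn _))
            · exact le_rfl
          split_ifs with hne
          · refine le_trans (le_of_eq ?_) (Finset.single_le_sum hnn
              (Finset.mem_filter.2 ⟨Finset.mem_univ _, hne⟩))
            rw [if_pos ⟨Finset.inter_subset_left, Finset.inter_subset_right⟩, prod_union_eq]
          · exact Finset.sum_nonneg hnn
      _ = _ := by
          rw [Finset.sum_congr rfl fun φ _ => Finset.sum_comm, Finset.sum_comm]
          refine Finset.sum_congr rfl fun H _ => ?_
          have hH : (cyclesThrough k H : Finset (Fin k → V)) =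
              (injWalks V k).filter fun φ => H ⊆ cycleEdges φ := by
            simp [cyclesThrough, injWalks, Finset.filter_filter]
          rw [hH, Finset.sum_filter, sq, Finset.sum_mul_sum, Finset.mul_sum]
          refine Finset.sum_congr rfl fun φ _ => ?_
          rw [Finset.mul_sum]
          refine Finset.sum_congr rfl fun ψ _ => ?_
          by_cases h1 : H ⊆ cycleEdges φ <;> by_cases h2 : H ⊆ cycleEdges ψ <;> simp [h1, h2]
  refine step1.trans ?_
  have step2 : ∀ H ∈ (Finset.univ.filter Finset.Nonempty : Finset (Finset (Sym2 V))),
      (∏ e ∈ H, p e) * (∑ φ ∈ cyclesThrough k H, ∏ e ∈ cycleEdges φ \ H, p e) ^ 2 ≤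
      Fintype.card (Fin k → Option (Fin k × Fin k)) * ∑ φ, ∑ ψ,
        ∑ I : Finset (Fin k), if I.Nonempty ∧ I.image (cycleEdge φ) = H then
          agreeWeight p I φ ψ else 0 := by
    intro H hH
    have hH := (Finset.mem_filter.1 hH).2
    obtain ⟨c, hc⟩ := exists_label (V := V) k H
    have hnn : ∀ φ ψ, 0 ≤ ∑ I : Finset (Fin k),
        if I.Nonempty ∧ I.image (cycleEdge φ) = H then agreeWeight p I φ ψ else 0 := by
      intro φ ψ
      refine Finset.sum_nonneg fun I _ => ?_
      split_ifs
      · exact agreeWeight_nonneg hp _ _ _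
      · exact le_rfl
    calc _ ≤ (∏ e ∈ H, p e) * (Fintype.card (Fin k → Option (Fin k × Fin k)) *
          ∑ φ ∈ cyclesThrough k H, ∑ ψ ∈ cyclesThrough k H, if c φ = c ψ then
            (∏ e ∈ cycleEdges φ \ H, p e) * (∏ e ∈ cycleEdges ψ \ H, p e) else 0) :=
          mul_le_mul_of_nonneg_left (sq_sum_le_card_mul_sum_same_label _ c _) (hpn H)
      _ ≤ _ := by
          rw [mul_left_comm]
          refine mul_le_mul_of_nonneg_left ?_ (Nat.cast_nonneg _)
          rw [Finset.mul_sum]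
          refine (Finset.sum_le_sum fun φ hφ => ?_).trans
            (Finset.sum_le_univ_sum_of_nonneg fun φ => Finset.sum_nonneg fun ψ _ => hnn φ ψ)
          rw [Finset.mul_sum]
          refine (Finset.sum_le_sum fun ψ hψ => ?_).trans
            (Finset.sum_le_univ_sum_of_nonneg fun ψ => hnn φ ψ)
          split_ifs with hcc
          · exact shared_term_le hk hp hH hφ hψ (hc φ hφ ψ hψ hcc)
          · rw [mul_zero]
            exact hnn φ ψ
  refine (Finset.sum_le_sum step2).trans ?_
  rw [← Finset.mul_sum]
  refine mul_le_mul_of_nonneg_left ?_ (Nat.cast_nonneg _)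
  have hagree := agreeWeight_nonneg (k := k) hp
  calc _ ≤ ∑ H : Finset (Sym2 V), ∑ φ : Fin k → V, ∑ ψ : Fin k → V,
        ∑ I : Finset (Fin k), (if I.Nonempty ∧ I.image (cycleEdge φ) = H then
          agreeWeight p I φ ψ else 0) := by
        refine Finset.sum_le_univ_sum_of_nonneg fun H => Finset.sum_nonneg fun φ _ =>
          Finset.sum_nonneg fun ψ _ => Finset.sum_nonneg fun I _ => ?_
        split_ifs
        · exact hagree _ _ _
        · exact le_rfl
    _ = ∑ φ : Fin k → V, ∑ ψ : Fin k → V, ∑ I : Finset (Fin k), ∑ H : Finset (Sym2 V),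
        (if I.Nonempty ∧ I.image (cycleEdge φ) = H then agreeWeight p I φ ψ else 0) := by
        rw [Finset.sum_comm]
        refine Finset.sum_congr rfl fun φ _ => ?_
        rw [Finset.sum_comm]
        exact Finset.sum_congr rfl fun ψ _ => Finset.sum_comm
    -- Only `H = I.image (cycleEdge φ)` contributes to the sum over `H`.
    _ = ∑ φ : Fin k → V, ∑ ψ : Fin k → V, ∑ I : Finset (Fin k),
        (if I.Nonempty then agreeWeight p I φ ψ else 0) := by
        refine Finset.sum_congr rfl fun φ _ => Finset.sum_congr rfl fun ψ _ =>
          Finset.sum_congr rfl fun I _ => ?_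
        simp_rw [ite_and]
        split_ifs <;> simp
    _ = ∑ I : Finset (Fin k), ∑ φ : Fin k → V, ∑ ψ : Fin k → V,
        (if I.Nonempty then agreeWeight p I φ ψ else 0) := by
        rw [Finset.sum_congr rfl fun φ _ => Finset.sum_comm, Finset.sum_comm]
    _ ≤ _ := by
        refine Finset.sum_le_sum fun I _ => ?_
        split_ifs <;> simp

end CycleEdges

/-! ### Moments of the number of cycles -/

instance (p : ℝ) : IsFiniteMeasure (bernoulliLaw p) := by
  unfold bernoulliLaw
  have h1 : IsFiniteMeasure (ENNReal.ofReal p • Measure.dirac True) :=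
    Measure.smul_finite _ ENNReal.ofReal_ne_top
  have h2 : IsFiniteMeasure (ENNReal.ofReal (1 - p) • Measure.dirac False) :=
    Measure.smul_finite _ ENNReal.ofReal_ne_top
  infer_instance

theorem bernoulliLaw_singleton_true (p : ℝ) : bernoulliLaw p {True} = ENNReal.ofReal p := by
  simp [bernoulliLaw]

theorem isProbabilityMeasure_bernoulliLaw {p : ℝ} (h0 : 0 ≤ p) (h1 : p ≤ 1) :
    IsProbabilityMeasure (bernoulliLaw p) := by
  constructor
  simp only [bernoulliLaw, Measure.coe_add, Measure.coe_smul, Pi.add_apply, Pi.smul_apply,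
    measure_univ, smul_eq_mul, mul_one]
  rw [← ENNReal.ofReal_add h0 (by linarith)]
  simp

theorem pi_bernoulliLaw_forall_mem {E : Type*} [Fintype E] {p : E → ℝ}
    (h0 : ∀ e, 0 ≤ p e) (h1 : ∀ e, p e ≤ 1) (s : Finset E) :
    (Measure.pi fun e => bernoulliLaw (p e)).real {ω | ∀ e ∈ s, ω e} = ∏ e ∈ s, p e := by
  classical
  have hprob := fun e => isProbabilityMeasure_bernoulliLaw (h0 e) (h1 e)
  have hset : {ω : E → Prop | ∀ e ∈ s, ω e} =
      Set.univ.pi fun e => if e ∈ s then {True} else Set.univ := by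
    ext ω
    simp only [Set.mem_ofPred_eq, Set.mem_pi, Set.mem_univ, true_implies]
    refine forall_congr' fun e => ?_
    by_cases he : e ∈ s <;> simp [he]
  rw [hset, measureReal_def, Measure.pi_pi, ENNReal.toReal_prod,
    ← Finset.prod_subset (Finset.subset_univ s)]
  · refine Finset.prod_congr rfl fun e he => ?_
    rw [if_pos he, bernoulliLaw_singleton_true, ENNReal.toReal_ofReal (h0 e)]
  · intro e _ he
    rw [if_neg he, measure_univ, ENNReal.toReal_one]

section Moments

variable {V : Type*} [Fintype V] [DecidableEq V] {k : ℕ} [NeZero k]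

open Classical in
/-- The number of injective closed walks of length `k` all of whose edges are selected. -/
noncomputable def cycleCount (k : ℕ) [NeZero k] (ω : Sym2 V → Prop) : ℝ :=
  ∑ φ ∈ injWalks V k, if ∀ e ∈ cycleEdges φ, ω e then 1 else 0

/-- A copy is determined by its vertex map, and adjacency in the cycle means consecutive indices. -/
theorem labelledCopyCount_cycleGraph (hk : 3 ≤ k) (ω : Sym2 V → Prop) :
    ((SimpleGraph.fromEdgeSet {e | ω e}).labelledCopyCount (SimpleGraph.cycleGraph k) : ℝ) =
      cycleCount k ω := by
  classical
  have hadj : ∀ i j : Fin k, (SimpleGraph.cycleGraph k).Adj i j ↔ j = i + 1 ∨ i = j + 1 := by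
    obtain ⟨m, rfl⟩ := Nat.exists_eq_add_of_le' hk
    intro i j
    rw [SimpleGraph.cycleGraph_adj, sub_eq_iff_eq_add', sub_eq_iff_eq_add']
    exact or_comm
  have e : SimpleGraph.Copy (SimpleGraph.cycleGraph k) (SimpleGraph.fromEdgeSet {e | ω e}) ≃
      {φ : Fin k → V // φ ∈ (injWalks V k).filter fun φ => ∀ e ∈ cycleEdges φ, ω e} :=
    { toFun := fun c => ⟨c, by
        simp only [injWalks, Finset.mem_filter, Finset.mem_univ, true_and]
        refine ⟨c.injective, fun e he => ?_⟩
        obtain ⟨i, -, rfl⟩ := Finset.mem_image.1 he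
        have := c.toHom.map_adj ((hadj i (i + 1)).2 (Or.inl rfl))
        exact ((SimpleGraph.fromEdgeSet_adj _).1 this).1⟩
      invFun := fun φ => ⟨⟨φ.1, by
        obtain ⟨φ, hφ⟩ := φ
        simp only [injWalks, Finset.mem_filter, Finset.mem_univ, true_and] at hφ
        intro i j hij
        have hstep : ∀ i, (SimpleGraph.fromEdgeSet {e | ω e}).Adj (φ i) (φ (i + 1)) := fun i =>
          (SimpleGraph.fromEdgeSet_adj _).2
            ⟨hφ.2 _ (Finset.mem_image_of_mem _ (Finset.mem_univ i)),
              fun h => Fin.add_one_ne_self (by omega) i (hφ.1 h).symm⟩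
        rcases (hadj i j).1 hij with rfl | rfl
        · exact hstep i
        · exact (hstep j).symm⟩, by
        have := φ.2
        simp only [injWalks, Finset.mem_filter, Finset.mem_univ, true_and] at this
        exact this.1⟩
      left_inv := fun c => rfl
      right_inv := fun φ => rfl }
  have h := Nat.card_congr e
  rw [Nat.card_eq_fintype_card, Nat.card_eq_fintype_card, Fintype.card_coe] at h
  rw [SimpleGraph.labelledCopyCount, cycleCount, Finset.sum_boole, Nat.cast_inj]
  convert! h

variable {p : Sym2 V → ℝ}

theorem integral_cycleCount (hk : 3 ≤ k) (h0 : ∀ e, 0 ≤ p e) (h1 : ∀ e, p e ≤ 1) :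
    ∫ ω, cycleCount k ω ∂(Measure.pi fun e => bernoulliLaw (p e)) =
      ∑ φ ∈ injWalks V k, ∏ i, p (cycleEdge φ i) := by
  classical
  unfold cycleCount
  rw [integral_finsetSum _ fun _ _ => Integrable.of_finite]
  refine Finset.sum_congr rfl fun φ hφ => ?_
  rw [← prod_cycleEdges hk (Finset.mem_filter.1 hφ).2, ← pi_bernoulliLaw_forall_mem h0 h1,
    ← integral_indicator_one (Set.toFinite _).measurableSet]
  congr 1
  ext ω
  rw [Set.indicator_apply]
  rfl

theorem integral_sq_cycleCount (h0 : ∀ e, 0 ≤ p e) (h1 : ∀ e, p e ≤ 1) :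
    ∫ ω, cycleCount k ω ^ 2 ∂(Measure.pi fun e => bernoulliLaw (p e)) =
      ∑ φ ∈ injWalks V k, ∑ ψ ∈ injWalks V k, ∏ e ∈ cycleEdges φ ∪ cycleEdges ψ, p e := by
  classical
  unfold cycleCount
  simp_rw [sq, Finset.sum_mul_sum]
  rw [integral_finsetSum _ fun _ _ => Integrable.of_finite]
  refine Finset.sum_congr rfl fun φ hφ => ?_
  rw [integral_finsetSum _ fun _ _ => Integrable.of_finite]
  refine Finset.sum_congr rfl fun ψ hψ => ?_
  rw [← pi_bernoulliLaw_forall_mem h0 h1,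
    ← integral_indicator_one (Set.toFinite _).measurableSet]
  congr 1
  ext ω
  rw [Set.indicator_apply, ite_zero_mul_ite_zero]
  simp only [mul_one, Set.mem_ofPred_eq, Finset.mem_union, or_imp, forall_and, Pi.one_apply]

/-- Pairs with disjoint edge sets contribute products of probabilities, covered by the squared mean;
only intersecting pairs need the second term. -/
theorem integral_sq_cycleCount_le (hk : 3 ≤ k) (h0 : ∀ e, 0 ≤ p e) (h1 : ∀ e, p e ≤ 1) :
    ∫ ω, cycleCount k ω ^ 2 ∂(Measure.pi fun e => bernoulliLaw (p e)) ≤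
      (∑ φ ∈ injWalks V k, ∏ i, p (cycleEdge φ i)) ^ 2 +
      Fintype.card (Fin k → Option (Fin k × Fin k)) *
        ∑ I : Finset (Fin k), if I.Nonempty then ∑ φ, ∑ ψ, agreeWeight p I φ ψ else 0 := by
  rw [integral_sq_cycleCount h0 h1]
  refine le_trans ?_ (add_le_add_right (sum_intersecting_pairs_le hk h0) _)
  rw [sq, Finset.sum_mul_sum, ← Finset.sum_add_distrib]
  refine Finset.sum_le_sum fun φ hφ => ?_
  rw [← Finset.sum_add_distrib]
  refine Finset.sum_le_sum fun ψ hψ => ?_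
  rw [← prod_cycleEdges hk (Finset.mem_filter.1 hφ).2, ← prod_cycleEdges hk (Finset.mem_filter.1 hψ).2]
  split_ifs with h
  · exact le_add_of_nonneg_left
      (mul_nonneg (Finset.prod_nonneg fun _ _ => h0 _) (Finset.prod_nonneg fun _ _ => h0 _))
  · rw [add_zero, Finset.prod_union
      (Finset.disjoint_iff_inter_eq_empty.2 (Finset.not_nonempty_iff_eq_empty.1 h))]

/-- A union bound over the pairs of times at which a non-injective walk can coincide. -/
theorem sum_walks_sub_sum_injWalks_le {w : (Fin k → V) → ℝ} (hw : ∀ φ, 0 ≤ w φ) :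
    ∑ φ, w φ - ∑ φ ∈ injWalks V k, w φ ≤
      ∑ i : Fin k, ∑ j : Fin k, if i ≠ j then ∑ φ, if φ i = φ j then w φ else 0 else 0 := by
  classical
  have h1 : ∑ φ, w φ - ∑ φ ∈ injWalks V k, w φ =
      ∑ φ, if Function.Injective φ then 0 else w φ := by
    rw [injWalks, Finset.sum_filter, ← Finset.sum_sub_distrib]
    refine Finset.sum_congr rfl fun φ _ => ?_
    split_ifs <;> simp
  have h2 : ∑ i : Fin k, ∑ j : Fin k, (if i ≠ j then ∑ φ, if φ i = φ j then w φ else 0 else 0) =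
      ∑ φ : Fin k → V, ∑ i : Fin k, ∑ j : Fin k,
        if i ≠ j then if φ i = φ j then w φ else 0 else 0 := by
    symm
    rw [Finset.sum_comm]
    refine Finset.sum_congr rfl fun i _ => ?_
    rw [Finset.sum_comm]
    refine Finset.sum_congr rfl fun j _ => ?_
    split_ifs <;> simp
  rw [h1, h2]
  refine Finset.sum_le_sum fun φ _ => ?_
  have hnn : ∀ i j : Fin k, 0 ≤ if i ≠ j then if φ i = φ j then w φ else 0 else 0 := by
    intro i j
    split_ifs
    exacts [hw φ, le_rfl, le_rfl]
  split_ifs with h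
  · exact Finset.sum_nonneg fun i _ => Finset.sum_nonneg fun j _ => hnn i j
  · simp only [Function.Injective, not_forall] at h
    obtain ⟨i, j, hij, hne⟩ := h
    refine le_trans (le_of_eq ?_) ((Finset.single_le_sum (fun j _ => hnn i j)
      (Finset.mem_univ j)).trans (Finset.single_le_sum
        (f := fun i => ∑ j : Fin k, if i ≠ j then if φ i = φ j then w φ else 0 else 0)
        (fun i _ => Finset.sum_nonneg fun j _ => hnn i j) (Finset.mem_univ i)))
    rw [if_pos hne, if_pos hij]

end Moments

/-! ### Asymptotics -/

theorem kroneckerProb_nonneg {α β : ℝ} (hα : 0 < α) (hβ : 0 < β) (n : ℕ)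
    (e : Sym2 (BinString n)) : 0 ≤ kroneckerProb α β α n e := by
  induction e with
  | _ u v =>
    rw [kroneckerProb_mk]
    exact Finset.prod_nonneg fun i _ => (kroneckerMatrix_pos hα hβ _ _).le

theorem kroneckerProb_le_one {α β : ℝ} (hα : 0 < α) (hβ : 0 < β) (hα1 : α ≤ 1) (hβ1 : β ≤ 1)
    (n : ℕ) (e : Sym2 (BinString n)) : kroneckerProb α β α n e ≤ 1 := by
  induction e with
  | _ u v =>
    rw [kroneckerProb_mk]
    exact Finset.prod_le_one (fun i _ => (kroneckerMatrix_pos hα hβ _ _).le)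
      fun i _ => kroneckerMatrix_le_one hα1 hβ1 _ _

/-- The law of the independent selection of pairs of vertices underlying `K(n, P)`. -/
noncomputable def selectionLaw (α β γ : ℝ) (n : ℕ) : Measure (Sym2 (BinString n) → Prop) :=
  Measure.pi fun e => bernoulliLaw (kroneckerProb α β γ n e)

theorem isProbabilityMeasure_selectionLaw {α β : ℝ} (hα : 0 < α) (hβ : 0 < β) (hα1 : α ≤ 1)
    (hβ1 : β ≤ 1) (n : ℕ) : IsProbabilityMeasure (selectionLaw α β α n) := by
  have := fun e => isProbabilityMeasure_bernoulliLaw (kroneckerProb_nonneg hα hβ n e)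
    (kroneckerProb_le_one hα hβ hα1 hβ1 n e)
  unfold selectionLaw
  infer_instance

theorem kroneckerAas_of_failure_le {α β : ℝ} (hα : 0 < α) (hβ : 0 < β) (hα1 : α ≤ 1)
    (hβ1 : β ≤ 1) {Q : ∀ n : ℕ, SimpleGraph (BinString n) → Prop} {r : ℕ → ℝ}
    (hr : Tendsto r atTop (𝓝 0))
    (h : ∀ n, (selectionLaw α β α n).real
      {ω | ¬ Q n (SimpleGraph.fromEdgeSet {e | ω e})} ≤ r n) :
    KroneckerAas α β α Q := by
  have hlim : Tendsto (fun n => 1 - ENNReal.ofReal (r n)) atTop (𝓝 1) := by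
    have h1 := (ENNReal.continuous_ofReal.tendsto 0).comp hr
    have h2 := ENNReal.Tendsto.sub (tendsto_const_nhds (x := (1 : ENNReal)) (f := atTop)) h1
      (Or.inl ENNReal.one_ne_top)
    simpa using h2
  refine tendsto_of_tendsto_of_tendsto_of_le_of_le hlim tendsto_const_nhds ?_ ?_
  · intro n
    have hp := isProbabilityMeasure_selectionLaw hα hβ hα1 hβ1 n
    have hmeas : Measurable fun ω : Sym2 (BinString n) → Prop =>
        SimpleGraph.fromEdgeSet {e | ω e} := measurable_of_finite _
    -- This inequality holds for every set, so measurability of the property is not needed.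
    refine le_trans ?_ (Measure.le_map_apply hmeas.aemeasurable _)
    have hc : (fun ω : Sym2 (BinString n) → Prop => SimpleGraph.fromEdgeSet {e | ω e}) ⁻¹'
        {G | Q n G} = {ω | ¬ Q n (SimpleGraph.fromEdgeSet {e | ω e})}ᶜ := by
      ext ω
      simp
    change _ ≤ selectionLaw α β α n _
    rw [hc, prob_compl_eq_one_sub (Set.toFinite _).measurableSet]
    refine tsub_le_tsub_left ?_ 1
    rw [← ofReal_measureReal]
    exact ENNReal.ofReal_le_ofReal (h n)
  · intro n
    have hp := isProbabilityMeasure_selectionLaw hα hβ hα1 hβ1 n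
    have : IsProbabilityMeasure (stochasticKronecker α β α n) :=
      Measure.isProbabilityMeasure_map (μ := selectionLaw α β α n)
        (measurable_of_finite _).aemeasurable
    exact prob_le_one

theorem kroneckerAas_mono {α β : ℝ} (hα : 0 < α) (hβ : 0 < β) (hα1 : α ≤ 1)
    (hβ1 : β ≤ 1) {Q R : ∀ n : ℕ, SimpleGraph (BinString n) → Prop}
    (hQ : KroneckerAas α β α Q) (hQR : ∀ n G, Q n G → R n G) : KroneckerAas α β α R := by
  refine tendsto_of_tendsto_of_tendsto_of_le_of_le hQ tendsto_const_nhds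
    (fun n => measure_mono fun G hG => hQR n G hG) fun n => ?_
  have hp := isProbabilityMeasure_selectionLaw hα hβ hα1 hβ1 n
  have : IsProbabilityMeasure (stochasticKronecker α β α n) :=
    Measure.isProbabilityMeasure_map (μ := selectionLaw α β α n)
      (measurable_of_finite _).aemeasurable
  exact prob_le_one

theorem integral_cycleCount_kronecker_le {α β : ℝ} (hα : 0 < α) (hβ : 0 < β) (hα1 : α ≤ 1)
    (hβ1 : β ≤ 1) {k : ℕ} [NeZero k] (hk : 3 ≤ k) (n : ℕ) :
    ∫ ω, cycleCount k ω ∂(selectionLaw α β α n) ≤ ((α + β) ^ k + (α - β) ^ k) ^ n := by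
  rw [selectionLaw, integral_cycleCount hk (kroneckerProb_nonneg hα hβ n)
    (kroneckerProb_le_one hα hβ hα1 hβ1 n), ← sum_kroneckerProb]
  exact Finset.sum_le_univ_sum_of_nonneg fun φ =>
    Finset.prod_nonneg fun _ _ => kroneckerProb_nonneg hα hβ n _

theorem sub_integral_cycleCount_kronecker_le {α β : ℝ} (hα : 0 < α) (hβ : 0 < β) (hα1 : α ≤ 1)
    (hβ1 : β ≤ 1) {k : ℕ} [NeZero k] (hk : 3 ≤ k) (n : ℕ) :
    ((α + β) ^ k + (α - β) ^ k) ^ n - ∫ ω, cycleCount k ω ∂(selectionLaw α β α n) ≤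
      ∑ i : Fin k, ∑ j : Fin k, if i ≠ j then coincidenceSum α β k i j ^ n else 0 := by
  rw [selectionLaw, integral_cycleCount hk (kroneckerProb_nonneg hα hβ n)
    (kroneckerProb_le_one hα hβ hα1 hβ1 n), ← sum_kroneckerProb]
  simp_rw [← sum_kroneckerProb_coincidence]
  exact sum_walks_sub_sum_injWalks_le fun φ =>
    Finset.prod_nonneg fun _ _ => kroneckerProb_nonneg hα hβ n _

theorem integral_sq_cycleCount_kronecker_le {α β : ℝ} (hα : 0 < α) (hβ : 0 < β) (hα1 : α ≤ 1)
    (hβ1 : β ≤ 1) {k : ℕ} [NeZero k] (hk : 3 ≤ k) (n : ℕ) :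
    ∫ ω, cycleCount k ω ^ 2 ∂(selectionLaw α β α n) ≤
      (∫ ω, cycleCount k ω ∂(selectionLaw α β α n)) ^ 2 +
      Fintype.card (Fin k → Option (Fin k × Fin k)) *
        ∑ I : Finset (Fin k), if I.Nonempty then overlapSum α β k I ^ n else 0 := by
  rw [selectionLaw, integral_cycleCount hk (kroneckerProb_nonneg hα hβ n)
    (kroneckerProb_le_one hα hβ hα1 hβ1 n)]
  simp_rw [← sum_kroneckerProb_overlap]
  exact integral_sq_cycleCount_le hk (kroneckerProb_nonneg hα hβ n)
    (kroneckerProb_le_one hα hβ hα1 hβ1 n)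

theorem cycleCount_nonneg {V : Type*} [Fintype V] [DecidableEq V] {k : ℕ} [NeZero k]
    (ω : Sym2 V → Prop) : 0 ≤ cycleCount k ω := by
  classical
  refine Finset.sum_nonneg fun φ _ => ?_
  split_ifs
  exacts [zero_le_one, le_rfl]

/-! ### Markov and Chebyshev bounds -/

theorem kroneckerAas_not_isContained_cycleGraph {α β : ℝ} (hα : 0 < α) (hβ : 0 < β)
    (hα1 : α ≤ 1) (hβ1 : β ≤ 1) {k : ℕ} [NeZero k] (hk : 3 ≤ k)
    (hlam : (α + β) ^ k + (α - β) ^ k < 1) :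
    KroneckerAas α β α fun _ G => ¬ (SimpleGraph.cycleGraph k).IsContained G := by
  have hlam0 : 0 ≤ (α + β) ^ k + (α - β) ^ k := by
    rw [← sum_closed_walks_kroneckerMatrix]
    exact Finset.sum_nonneg fun _ _ =>
      Finset.prod_nonneg fun _ _ => (kroneckerMatrix_pos hα hβ _ _).le
  refine kroneckerAas_of_failure_le hα hβ hα1 hβ1
    (tendsto_pow_atTop_nhds_zero_of_lt_one hlam0 hlam) fun n => ?_
  have hp := isProbabilityMeasure_selectionLaw hα hβ hα1 hβ1 n
  refine le_trans ?_ (integral_cycleCount_kronecker_le hα hβ hα1 hβ1 hk n)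
  -- The level 1 suffices because a positive count is at least 1.
  have hmarkov := mul_meas_ge_le_integral_of_nonneg (μ := selectionLaw α β α n)
    (f := cycleCount k) (Eventually.of_forall cycleCount_nonneg) Integrable.of_finite 1
  rw [one_mul] at hmarkov
  refine (measureReal_mono fun ω hω => ?_).trans hmarkov
  have hω : (SimpleGraph.cycleGraph k).IsContained (SimpleGraph.fromEdgeSet {e | ω e}) :=
    not_not.1 hω
  have := SimpleGraph.labelledCopyCount_pos.2 hω
  change 1 ≤ cycleCount k ω
  rw [← labelledCopyCount_cycleGraph hk]
  exact_mod_cast this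

/-- Chebyshev's inequality is applied around `L ^ n` instead of the mean. Relative to `L ^ n`, the
bias is at most `N n` and the variance at most `K * R n`; both are finite sums of geometric
sequences with ratio below 1. -/
theorem kroneckerAas_cycleCount_concentration {α β : ℝ} (hα : 0 < α) (hβ : 0 < β)
    (hα1 : α ≤ 1) (hβ1 : β < 1) {k : ℕ} [NeZero k] (hk : 3 ≤ k)
    (hlam : 1 < (α + β) ^ k + (α - β) ^ k) {ε : ℝ} (hε : 0 < ε) :
    KroneckerAas α β α fun n G =>
      |(G.labelledCopyCount (SimpleGraph.cycleGraph k) : ℝ) - ((α + β) ^ k + (α - β) ^ k) ^ n|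
        ≤ ε * ((α + β) ^ k + (α - β) ^ k) ^ n := by
  set L := (α + β) ^ k + (α - β) ^ k with hL
  have hL0 : 0 < L := by linarith
  have hnull : ∀ {ρ τ : ℝ}, 0 ≤ ρ → ρ < τ → Tendsto (fun n : ℕ => (ρ / τ) ^ n) atTop (𝓝 0) :=
    fun hρ hτ => tendsto_pow_atTop_nhds_zero_of_lt_one (div_nonneg hρ (hρ.trans hτ.le))
      ((div_lt_one (hρ.trans_lt hτ)).2 hτ)
  let K : ℝ := Fintype.card (Fin k → Option (Fin k × Fin k))
  let N : ℕ → ℝ := fun n =>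
    ∑ i : Fin k, ∑ j : Fin k, if i ≠ j then (coincidenceSum α β k i j / L) ^ n else 0
  let R : ℕ → ℝ := fun n =>
    ∑ I : Finset (Fin k), if I.Nonempty then (overlapSum α β k I / L ^ 2) ^ n else 0
  have hN : Tendsto N atTop (𝓝 0) := by
    rw [show (0 : ℝ) = ∑ i : Fin k, ∑ j : Fin k, 0 by simp]
    refine tendsto_finsetSum _ fun i _ => tendsto_finsetSum _ fun j _ => ?_
    split_ifs with hij
    · exact hnull (coincidenceSum_nonneg hα hβ k i j) (coincidenceSum_lt hα hβ hij)
    · exact tendsto_const_nhds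
  have hR : Tendsto R atTop (𝓝 0) := by
    rw [show (0 : ℝ) = ∑ I : Finset (Fin k), 0 by simp]
    refine tendsto_finsetSum _ fun I _ => ?_
    split_ifs with hI
    · exact hnull (overlapSum_nonneg hα hβ k I) (overlapSum_lt hα hβ hβ1 hI hlam)
    · exact tendsto_const_nhds
  have hr : Tendsto (fun n => (N n ^ 2 + K * R n) / ε ^ 2) atTop (𝓝 0) := by
    have := ((hN.pow 2).add (hR.const_mul K)).div_const (ε ^ 2)
    simpa using this
  refine kroneckerAas_of_failure_le hα hβ hα1 hβ1.le hr fun n => ?_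
  have hp := isProbabilityMeasure_selectionLaw hα hβ hα1 hβ1.le n
  have hLn : 0 < L ^ n := pow_pos hL0 n
  have h1 := integral_cycleCount_kronecker_le hα hβ hα1 hβ1.le hk n
  have h2 := sub_integral_cycleCount_kronecker_le hα hβ hα1 hβ1.le hk n
  have h3 := integral_sq_cycleCount_kronecker_le hα hβ hα1 hβ1.le hk n
  have hNn : ∑ i : Fin k, ∑ j : Fin k, (if i ≠ j then coincidenceSum α β k i j ^ n else 0) =
      L ^ n * N n := by
    simp only [N, Finset.mul_sum, mul_ite, mul_zero, div_pow, mul_div_cancel₀ _ hLn.ne']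
  have hRn : ∑ I : Finset (Fin k), (if I.Nonempty then overlapSum α β k I ^ n else 0) =
      (L ^ n) ^ 2 * R n := by
    have : (L ^ 2) ^ n ≠ 0 := (pow_pos (pow_pos hL0 2) n).ne'
    rw [← pow_mul, mul_comm n 2, pow_mul]
    simp only [R, Finset.mul_sum, mul_ite, mul_zero, div_pow, mul_div_cancel₀ _ this]
  rw [← hL] at h1 h2
  rw [hNn] at h2
  rw [hRn] at h3
  have hsq : ∫ ω, (cycleCount k ω - L ^ n) ^ 2 ∂(selectionLaw α β α n) =
      ∫ ω, cycleCount k ω ^ 2 ∂(selectionLaw α β α n) -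
        2 * L ^ n * ∫ ω, cycleCount k ω ∂(selectionLaw α β α n) + (L ^ n) ^ 2 := by
    have : ∀ ω : Sym2 (BinString n) → Prop, (cycleCount k ω - L ^ n) ^ 2 =
        cycleCount k ω ^ 2 - 2 * L ^ n * cycleCount k ω + (L ^ n) ^ 2 := fun ω => by ring
    simp_rw [this]
    rw [integral_add Integrable.of_finite Integrable.of_finite,
      integral_sub Integrable.of_finite Integrable.of_finite, integral_const_mul]
    simp
  have hmarkov := mul_meas_ge_le_integral_of_nonneg (μ := selectionLaw α β α n)
    (f := fun ω => (cycleCount k ω - L ^ n) ^ 2) (Eventually.of_forall fun _ => sq_nonneg _)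
    Integrable.of_finite ((ε * L ^ n) ^ 2)
  rw [hsq] at hmarkov
  have hbound : ∫ ω, cycleCount k ω ^ 2 ∂(selectionLaw α β α n) -
        2 * L ^ n * ∫ ω, cycleCount k ω ∂(selectionLaw α β α n) + (L ^ n) ^ 2 ≤
      (L ^ n) ^ 2 * (N n ^ 2 + K * R n) := by
    -- The mean does not exceed `L ^ n`, so the bias is nonnegative and its bound may be squared.
    have h4 := pow_le_pow_left₀ (sub_nonneg.2 h1) h2 2
    calc _ ≤ (L ^ n - ∫ ω, cycleCount k ω ∂(selectionLaw α β α n)) ^ 2 +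
          K * ((L ^ n) ^ 2 * R n) := by linarith
      _ ≤ _ := by linarith
  have hfinal : (ε * L ^ n) ^ 2 * (selectionLaw α β α n).real
      {ω | (ε * L ^ n) ^ 2 ≤ (cycleCount k ω - L ^ n) ^ 2} ≤
      (ε * L ^ n) ^ 2 * ((N n ^ 2 + K * R n) / ε ^ 2) := by
    refine (hmarkov.trans hbound).trans (le_of_eq ?_)
    field_simp
  refine (measureReal_mono fun ω hω => ?_).trans
    (le_of_mul_le_mul_left hfinal (pow_pos (mul_pos hε hLn) 2))
  have hω : ¬ |((SimpleGraph.fromEdgeSet {e | ω e}).labelledCopyCount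
      (SimpleGraph.cycleGraph k) : ℝ) - L ^ n| ≤ ε * L ^ n := hω
  rw [labelledCopyCount_cycleGraph hk, not_le] at hω
  change (ε * L ^ n) ^ 2 ≤ (cycleCount k ω - L ^ n) ^ 2
  rw [← sq_abs (cycleCount k ω - L ^ n)]
  exact pow_le_pow_left₀ (mul_pos hε hLn).le hω.le 2

theorem theorem3 (k : ℕ) (hk : 3 ≤ k) (α β γ : ℝ)
    (hα : 0 < α ∧ α < 1) (hβ : 0 < β ∧ β < 1) (hγ : 0 < γ ∧ γ < 1) (hαγ : α = γ) :
    ((α + β) ^ k + (α - β) ^ k < 1 →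
      KroneckerAas α β γ fun _ G => ¬ (SimpleGraph.cycleGraph k).IsContained G) ∧
    ((α + β) ^ k + (α - β) ^ k > 1 →
      KroneckerAas α β γ fun _ G => (SimpleGraph.cycleGraph k).IsContained G) ∧
    ((α + β) ^ k + (α - β) ^ k > 1 → ∀ ε : ℝ, 0 < ε →
      KroneckerAas α β γ fun n G =>
        |(G.labelledCopyCount (SimpleGraph.cycleGraph k) : ℝ)
            - ((α + β) ^ k + (α - β) ^ k) ^ n|
          ≤ ε * ((α + β) ^ k + (α - β) ^ k) ^ n) := by

  subst hαγ
  have : NeZero k := ⟨by omega⟩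
  have hconc : (α + β) ^ k + (α - β) ^ k > 1 → ∀ ε : ℝ, 0 < ε →
      KroneckerAas α β α fun n G =>
        |(G.labelledCopyCount (SimpleGraph.cycleGraph k) : ℝ)
            - ((α + β) ^ k + (α - β) ^ k) ^ n|
          ≤ ε * ((α + β) ^ k + (α - β) ^ k) ^ n := fun hlam ε hε =>
    kroneckerAas_cycleCount_concentration hα.1 hβ.1 hα.2.le hβ.2 hk hlam hε
  refine ⟨kroneckerAas_not_isContained_cycleGraph hα.1 hβ.1 hα.2.le hβ.2.le hk,
    fun hlam => ?_, hconc⟩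
  -- Any `ε < 1` would do: the count is then at least `(1 - ε) λ ^ n > 0`.
  refine kroneckerAas_mono hα.1 hβ.1 hα.2.le hβ.2.le (hconc hlam (1 / 2) one_half_pos)
    fun n G hG => ?_
  have hpos : 0 < ((α + β) ^ k + (α - β) ^ k) ^ n := pow_pos (by linarith) n
  have hcount : (0 : ℝ) < G.labelledCopyCount (SimpleGraph.cycleGraph k) := by
    have := (abs_le.1 hG).1
    linarith
  exact SimpleGraph.labelledCopyCount_pos.1 (by exact_mod_cast hcount)
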